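/- Let $1\le N\le K-1$, let $p$ be a prime power, and let $L^{[1]},\dots,L^{[K]}$ be nonnegative integers. A key block consists of independent random variables $s_{\mathcal U}$, one for each nonempty $\mathcal U\subseteq\{1,\dots,K\}$, where $s_{\mathcal U}$ consists of $L^{[|\mathcal U|]}$ independent uniform symbols of $\mathbb F_p$ (symmetric setting: the size depends only on $|\mathcal U|$). For $L$ i.i.d. key blocks, let $Z_k$ collect the blocks of all $s_{\mathcal U}$ with $k\in\mathcal U$; Receiver $k$ knows $Z_k$. A groupcast scheme of block length $L$ has a message $W$ of $L_W$ uniform symbols of $\mathbb F_p$, independent of the keys, and a transmit signal $X$ of $L_X$ symbols of $\mathbb F_p$, produced from $W$ and all the keys (possibly with randomization) and seen by all the receivers; its rate is $L_W\log_2 p/L$ and its broadcast bandwidth is $L_X\log_2 p/L$. A sequence of schemes, indexed by $L=1,2,\dots$, is called admissible if it is correct, in the sense that every legitimate Receiver $k\in\{1,\dots,N\}$ decodes $W$ from $(X,Z_k)$ with error probability tending to $0$ (or, alternatively, in the sense that $H(W\mid X,Z_k)=o(L)$ for all these $k$), and secure, in the sense that $I(W;X,Z_k)=o(L)$ for every $k\in\{N+1,\dots,K\}$.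 The capacity $C$ is the supremum of the $R$ for which there is an admissible sequence of schemes all of rate at least $R$; $\beta^*(R)$ is the infimum of the $\beta$ for which there is an admissible sequence of schemes all of rate at least $R$ and of broadcast bandwidth at most $\beta$. Then, for either form of the correctness requirement, $$C=\sum_{u=1}^K\binom{K-2}{u-1}L^{[u]}\log_2 p,\qquad \beta^*(C)=\sum_{u=1}^K\left(\binom{K-1}{u}-\binom{K-N-1}{u}\right)L^{[u]}\log_2 p,$$ where $\binom{a}{b}=0$ for $a<b$; in particular, there are admissible sequences of schemes all of rate at least $C$. -/

import Mathlib

open Filter Asymptotics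

namespace SecureGroupcast

noncomputable section

/-! ### Finite information theory (all quantities in bits) -/

/-- The probability that the random variable `f` takes the value `a`. -/
def prob {Ω α : Type*} (P : PMF Ω) (f : Ω → α) (a : α) : ℝ :=
  (P.map f a).toReal

/-- Shannon entropy `H(f)` of a random variable with finite alphabet. -/
def entropy {Ω α : Type*} [Fintype α] (P : PMF Ω) (f : Ω → α) : ℝ :=
  -∑ a, prob P f a * Real.logb 2 (prob P f a)

/-- Conditional entropy `H(f | g) = -∑ p(a,b) log₂ (p(a,b) / p(b))`. -/
def condEntropy {Ω α β : Type*} [Fintype α] [Fintype β]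
    (P : PMF Ω) (f : Ω → α) (g : Ω → β) : ℝ :=
  -∑ a, ∑ b, prob P (fun ω => (f ω, g ω)) (a, b) *
    Real.logb 2 (prob P (fun ω => (f ω, g ω)) (a, b) / prob P g b)

/-- Mutual information `I(f ; g) = H(f) - H(f | g)`. -/
def mutualInfo {Ω α β : Type*} [Fintype α] [Fintype β]
    (P : PMF Ω) (f : Ω → α) (g : Ω → β) : ℝ :=
  entropy P f - condEntropy P f g

/-! ### Combinatorial keys

The receivers are indexed by `Fin K`. For every nonempty set `U` of receivers, one key block holds
a vector of `ℓ U` symbols of the finite field `F`, known exactly to the receivers in `U`. -/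

/-- `L` blocks of all key variables, i.e. the values of `(s_U)_U` for blocks `0, …, L - 1`. -/
abbrev Keys (F : Type*) {K : ℕ} (ℓ : Finset (Fin K) → ℕ) (L : ℕ) : Type _ :=
  Fin L → (U : {U : Finset (Fin K) // U.Nonempty}) → Fin (ℓ U.1) → F

/-- The alphabet of `Z_k`: `L` blocks of the key variables `s_U` with `k ∈ U`. -/
abbrev ReceiverKey (F : Type*) {K : ℕ} (ℓ : Finset (Fin K) → ℕ) (L : ℕ) (k : Fin K) : Type _ :=
  Fin L → (U : {U : Finset (Fin K) // k ∈ U}) → Fin (ℓ U.1) → F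

/-- The key `Z_k` of Receiver `k` as a function of all the keys. -/
def receiverKey {F : Type*} {K : ℕ} {ℓ : Finset (Fin K) → ℕ} {L : ℕ} (k : Fin K)
    (s : Keys F ℓ L) : ReceiverKey F ℓ L k :=
  fun l U => s l ⟨U.1, ⟨k, U.2⟩⟩

/-! ### Secure groupcast schemes

Receivers `k` with `k < N` are the legitimate ones, the others are the eavesdroppers. -/

/-- A groupcast scheme over `L` key blocks: the message consists of `LW` symbols and the transmit
signal of `LX` symbols of `F`. The transmitter knows the message and all the keys and may
randomize; legitimate Receiver `k` decodes from the transmit signal and `Z_k`. -/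
structure Scheme (F : Type*) {K : ℕ} (ℓ : Finset (Fin K) → ℕ) (N L : ℕ) where
  LW : ℕ
  LX : ℕ
  enc : (Fin LW → F) → Keys F ℓ L → PMF (Fin LX → F)
  dec : (k : {k : Fin K // k.val < N}) → (Fin LX → F) → ReceiverKey F ℓ L k.1 → (Fin LW → F)

namespace Scheme

variable {F : Type*} {K : ℕ} {ℓ : Finset (Fin K) → ℕ} {N L : ℕ}

/-- The sample space of a scheme: message, keys, transmit signal. -/
abbrev Sample (c : Scheme F ℓ N L) : Type _ :=
  (Fin c.LW → F) × Keys F ℓ L × (Fin c.LX → F)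

/-- The message `W`. -/
def msg (c : Scheme F ℓ N L) (ω : c.Sample) : Fin c.LW → F := ω.1

/-- The pair `(X, Z_k)` observed by Receiver `k`. -/
def view (c : Scheme F ℓ N L) (k : Fin K) (ω : c.Sample) :
    (Fin c.LX → F) × ReceiverKey F ℓ L k :=
  (ω.2.2, receiverKey k ω.2.1)

/-- The joint law of message, keys and transmit signal: the message and all the key symbols are
independent and uniform, and the transmit signal is produced from them by the encoder. -/
def law [Fintype F] [Nonempty F] (c : Scheme F ℓ N L) : PMF c.Sample :=
  (PMF.uniformOfFintype ((Fin c.LW → F) × Keys F ℓ L)).bind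
    fun ws => (c.enc ws.1 ws.2).map fun x => (ws.1, ws.2, x)

/-- The probability that legitimate Receiver `k` does not recover the message. -/
def errorProb [Fintype F] [Nonempty F] (c : Scheme F ℓ N L) (k : {k : Fin K // k.val < N}) : ℝ :=
  prob c.law (fun ω => c.dec k (c.view k.1 ω).1 (c.view k.1 ω).2 ≠ c.msg ω) True

/-- `H(W | X, Z_k)`. -/
def equivocation [Fintype F] [Nonempty F] (c : Scheme F ℓ N L) (k : Fin K) : ℝ :=
  condEntropy c.law c.msg (c.view k)

/-- `I(W ; X, Z_k)`. -/
def leakage [Fintype F] [Nonempty F] (c : Scheme F ℓ N L) (k : Fin K) : ℝ :=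
  mutualInfo c.law c.msg (c.view k)

/-- The rate, in bits per key block. -/
def rate [Fintype F] (c : Scheme F ℓ N L) : ℝ :=
  c.LW * Real.logb 2 (Fintype.card F) / L

/-- The broadcast bandwidth, in bits per key block. -/
def bandwidth [Fintype F] (c : Scheme F ℓ N L) : ℝ :=
  c.LX * Real.logb 2 (Fintype.card F) / L

end Scheme

/-- The two customary forms of the correctness requirement. -/
inductive Reliability
  /-- The decoding error probabilities tend to zero. -/
  | vanishingError
  /-- `H(W | X, Z_k) = o(L)` for every legitimate Receiver `k`. -/
  | vanishingEquivocation

variable {F : Type*} [Fintype F] [Nonempty F] {K : ℕ} {ℓ : Finset (Fin K) → ℕ} {N : ℕ}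

/-- Correctness of a sequence of schemes, indexed by the key block length `L`. -/
def IsCorrect (r : Reliability) (c : (L : ℕ) → Scheme F ℓ N L) : Prop :=
  match r with
  | .vanishingError =>
      ∀ k : {k : Fin K // k.val < N}, Tendsto (fun L => (c L).errorProb k) atTop (nhds 0)
  | .vanishingEquivocation =>
      ∀ k : Fin K, k.val < N →
        (fun L : ℕ => (c L).equivocation k) =o[atTop] fun L : ℕ => (L : ℝ)

/-- Security of a sequence of schemes: `I(W ; X, Z_k) = o(L)` for every eavesdropper `k`. -/
def IsSecure (c : (L : ℕ) → Scheme F ℓ N L) : Prop :=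
  ∀ k : Fin K, N ≤ k.val → (fun L : ℕ => (c L).leakage k) =o[atTop] fun L : ℕ => (L : ℝ)

variable (F ℓ N)

/-- The rate `R` is achievable for groupcast to the first `N` receivers. -/
def AchievableRate (r : Reliability) (R : ℝ) : Prop :=
  ∃ c : (L : ℕ) → Scheme F ℓ N L,
    IsCorrect r c ∧ IsSecure c ∧ ∀ L : ℕ, 0 < L → R ≤ (c L).rate

/-- The broadcast bandwidth `β` is achievable at rate `R`. -/
def AchievableBandwidth (r : Reliability) (R β : ℝ) : Prop :=
  ∃ c : (L : ℕ) → Scheme F ℓ N L,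
    IsCorrect r c ∧ IsSecure c ∧ ∀ L : ℕ, 0 < L → R ≤ (c L).rate ∧ (c L).bandwidth ≤ β

/-- `C` is the capacity: the supremum of the achievable rates. -/
def IsCapacity (r : Reliability) (C : ℝ) : Prop :=
  IsLUB {R : ℝ | AchievableRate F ℓ N r R} C

/-- `β` is the minimum broadcast bandwidth at rate `R`: the infimum of the broadcast bandwidths
achievable at rate `R` (there has to be one). -/
def IsMinBandwidth (r : Reliability) (R β : ℝ) : Prop :=
  IsGLB {b : ℝ | AchievableBandwidth F ℓ N r R b} β

end

end SecureGroupcast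

/-! Converse. For a legitimate receiver k and an eavesdropper e, submodularity gives H(Z_k |
W,X,Z_e) ≤ H(W | X,Z_k) + I(W; X,Z_e) − H(W) + H(Z_k | Z_e) (`key_equivocation_le`). The left side
is nonnegative and H(Z_k | Z_e) counts the key symbols of the sets containing k but not e, so this
count bounds the rate (`msg_length_le`). At a rate equal to the bound, the right side is at most
o(L): given W and Z_e, the signal reveals almost all keys of every legitimate receiver. It therefore
needs as many symbols as there are keys known to some legitimate receiver and not to e
(`key_length_le`).

Achievability. Fix one eavesdropper e₀. For each symbol index i of each U that meets the legitimate
receivers and avoids e₀, send a codeword symbol of W masked by s_U plus the sum, over eavesdroppers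
a in U, of s_V with V = U − a + e₀, always taking symbol i. A legitimate member of U knows the whole
mask, so it sees as many codeword symbols as the capacity count, and an MDS code of that dimension
returns W. Every eavesdropper finds the masks jointly uniform: any change of the masks is produced
by a key shift it does not see (`keyCombination_keyShift`).

Both counts follow from counting subsets by size (`keyCount_mem_notMem`,
`keyCount_legitimate_notMem`). -/

namespace SecureGroupcast

/-! ### Shannon inequalities for finite alphabets. -/

section InformationTheory

variable {Ω α β γ : Type*} (P : PMF Ω)

lemma pmf_toReal_nonneg (ω : Ω) : 0 ≤ (P ω).toReal := ENNReal.toReal_nonneg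

lemma prob_nonneg (f : Ω → α) (a : α) : 0 ≤ prob P f a := ENNReal.toReal_nonneg

variable [Fintype Ω]

lemma sum_pmf_toReal : ∑ ω, (P ω).toReal = 1 := by
  rw [← ENNReal.toReal_sum (fun a _ => P.apply_ne_top a), ← tsum_fintype (L := .unconditional Ω),
    P.tsum_coe, ENNReal.toReal_one]

open Classical in
lemma prob_eq_sum (f : Ω → α) (a : α) :
    prob P f a = ∑ ω, if f ω = a then (P ω).toReal else 0 := by
  unfold prob
  rw [PMF.map_apply, tsum_fintype, ENNReal.toReal_sum]
  · refine Finset.sum_congr rfl fun ω _ => ?_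
    by_cases h : f ω = a
    · simp [h]
    · simp [h, Ne.symm h]
  · intro ω _
    split_ifs
    · exact P.apply_ne_top ω
    · exact ENNReal.zero_ne_top

lemma sum_prob_mul [Fintype α] (f : Ω → α) (φ : α → ℝ) :
    ∑ a, prob P f a * φ a = ∑ ω, (P ω).toReal * φ (f ω) := by
  classical
  simp only [prob_eq_sum, Finset.sum_mul, ite_mul, zero_mul]
  rw [Finset.sum_comm]
  simp

lemma sum_prob [Fintype α] (f : Ω → α) : ∑ a, prob P f a = 1 := by
  simpa [sum_pmf_toReal] using sum_prob_mul P f (fun _ => 1)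

lemma sum_prob_fst [Fintype α] (f : Ω → α) (g : Ω → β) (b : β) :
    ∑ a, prob P (fun ω => (f ω, g ω)) (a, b) = prob P g b := by
  classical
  simp only [prob_eq_sum, Prod.mk.injEq]
  rw [Finset.sum_comm]
  refine Finset.sum_congr rfl fun ω _ => ?_
  by_cases h : g ω = b <;> simp [h]

lemma sum_prob_snd [Fintype β] (f : Ω → α) (g : Ω → β) (a : α) :
    ∑ b, prob P (fun ω => (f ω, g ω)) (a, b) = prob P f a := by
  classical
  simp only [prob_eq_sum, Prod.mk.injEq]
  rw [Finset.sum_comm]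
  refine Finset.sum_congr rfl fun ω _ => ?_
  by_cases h : f ω = a <;> simp [h]

lemma prob_pair_le_snd [Fintype α] (f : Ω → α) (g : Ω → β) (a : α) (b : β) :
    prob P (fun ω => (f ω, g ω)) (a, b) ≤ prob P g b := by
  rw [← sum_prob_fst P f g b]
  exact Finset.single_le_sum (f := fun a => prob P (fun ω => (f ω, g ω)) (a, b))
    (fun a _ => prob_nonneg P _ _) (Finset.mem_univ a)

lemma prob_congr (f : Ω → α) (g : Ω → β) (h : ∀ ω ω', f ω = f ω' ↔ g ω = g ω') (ω : Ω) :
    prob P f (f ω) = prob P g (g ω) := by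
  classical
  simp only [prob_eq_sum, h]

lemma entropy_eq_sum [Fintype α] (f : Ω → α) :
    entropy P f = -∑ ω, (P ω).toReal * Real.logb 2 (prob P f (f ω)) := by
  rw [entropy, sum_prob_mul P f (fun a => Real.logb 2 (prob P f a))]

/-- Entropy depends only on the partition induced by the random variable. -/
lemma entropy_congr [Fintype α] [Fintype β] (f : Ω → α) (g : Ω → β)
    (h : ∀ ω ω', f ω = f ω' ↔ g ω = g ω') : entropy P f = entropy P g := by
  simp only [entropy_eq_sum, prob_congr P f g h]

/-- Chain rule. -/
lemma condEntropy_eq_sub [Fintype α] [Fintype β] (f : Ω → α) (g : Ω → β) :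
    condEntropy P f g = entropy P (fun ω => (f ω, g ω)) - entropy P g := by
  have key : ∀ a b, prob P (fun ω => (f ω, g ω)) (a, b) *
      Real.logb 2 (prob P (fun ω => (f ω, g ω)) (a, b) / prob P g b) =
      prob P (fun ω => (f ω, g ω)) (a, b) * Real.logb 2 (prob P (fun ω => (f ω, g ω)) (a, b)) -
      prob P (fun ω => (f ω, g ω)) (a, b) * Real.logb 2 (prob P g b) := by
    intro a b
    rcases (prob_nonneg P (fun ω => (f ω, g ω)) (a, b)).eq_or_lt with h | h
    · simp [← h]
    · have hb : 0 < prob P g b := h.trans_le (prob_pair_le_snd P f g a b)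
      rw [Real.logb_div h.ne' hb.ne', mul_sub]
  have h2 : ∑ a, ∑ b, prob P (fun ω => (f ω, g ω)) (a, b) * Real.logb 2 (prob P g b) =
      ∑ b, prob P g b * Real.logb 2 (prob P g b) := by
    rw [Finset.sum_comm]
    refine Finset.sum_congr rfl fun b _ => ?_
    rw [← Finset.sum_mul, sum_prob_fst]
  simp only [condEntropy, entropy, key, Finset.sum_sub_distrib, h2, Fintype.sum_prod_type]
  ring

lemma logb_le_div_sub_one {x : ℝ} (hx : 0 < x) : Real.logb 2 x ≤ (x - 1) / Real.log 2 := by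
  rw [Real.logb]
  have := Real.log_pos (x := 2) (by norm_num)
  gcongr
  exact Real.log_le_sub_one_of_pos hx

/-- Gibbs' inequality for conditional distributions. -/
lemma condEntropy_le_cross [Fintype α] [Fintype β] (f : Ω → α) (g : Ω → β) (q : α → β → ℝ)
    (hq : ∀ a b, 0 ≤ q a b) (hq1 : ∀ b, ∑ a, q a b ≤ 1)
    (hpos : ∀ a b, 0 < prob P (fun ω => (f ω, g ω)) (a, b) → 0 < q a b) :
    condEntropy P f g ≤
      -∑ a, ∑ b, prob P (fun ω => (f ω, g ω)) (a, b) * Real.logb 2 (q a b) := by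
  have hlog := Real.log_pos (x := 2) (by norm_num)
  -- This is log x ≤ x − 1 at x = q(a,b) / p(a|b). After summation the bound is nonpositive even if
  -- q is only subnormalised.
  have key : ∀ a b, prob P (fun ω => (f ω, g ω)) (a, b) * Real.logb 2 (q a b) -
      prob P (fun ω => (f ω, g ω)) (a, b) *
        Real.logb 2 (prob P (fun ω => (f ω, g ω)) (a, b) / prob P g b) ≤
      (q a b * prob P g b - prob P (fun ω => (f ω, g ω)) (a, b)) / Real.log 2 := by
    intro a b
    rcases (prob_nonneg P (fun ω => (f ω, g ω)) (a, b)).eq_or_lt with h | h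
    · rw [← h]
      simp only [zero_mul, sub_zero]
      exact div_nonneg (mul_nonneg (hq a b) (prob_nonneg P g b)) hlog.le
    · have hb : 0 < prob P g b := h.trans_le (prob_pair_le_snd P f g a b)
      have hqa := hpos a b h
      rw [← mul_sub, ← Real.logb_div hqa.ne' (div_pos h hb).ne']
      refine (mul_le_mul_of_nonneg_left (logb_le_div_sub_one
        (div_pos hqa (div_pos h hb))) h.le).trans (le_of_eq ?_)
      field_simp
  have hsum := Finset.sum_le_sum fun a (_ : a ∈ Finset.univ) =>
    Finset.sum_le_sum fun b (_ : b ∈ Finset.univ) => key a b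
  have h0 : ∑ a, ∑ b, (q a b * prob P g b - prob P (fun ω => (f ω, g ω)) (a, b)) / Real.log 2
      ≤ 0 := by
    simp only [← Finset.sum_div]
    refine div_nonpos_of_nonpos_of_nonneg ?_ hlog.le
    rw [Finset.sum_comm]
    refine Finset.sum_nonpos fun b _ => ?_
    rw [Finset.sum_sub_distrib, ← Finset.sum_mul, sum_prob_fst]
    nlinarith [hq1 b, prob_nonneg P g b]
  simp only [Finset.sum_sub_distrib] at hsum
  rw [condEntropy]
  linarith

lemma condEntropy_nonneg [Fintype α] [Fintype β] (f : Ω → α) (g : Ω → β) :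
    0 ≤ condEntropy P f g := by
  rw [condEntropy, neg_nonneg]
  refine Finset.sum_nonpos fun a _ => Finset.sum_nonpos fun b _ => ?_
  refine mul_nonpos_of_nonneg_of_nonpos (prob_nonneg P _ _)
    (Real.logb_nonpos (by norm_num) (div_nonneg (prob_nonneg P _ _) (prob_nonneg P _ _)) ?_)
  exact div_le_one_of_le₀ (prob_pair_le_snd P f g a b) (prob_nonneg P _ _)

lemma condEntropy_le_logb_card [Fintype α] [Nonempty α] [Fintype β] (f : Ω → α) (g : Ω → β) :
    condEntropy P f g ≤ Real.logb 2 (Fintype.card α) := by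
  have hc : (0 : ℝ) < Fintype.card α := by exact_mod_cast Fintype.card_pos
  refine (condEntropy_le_cross P f g (fun _ _ => (Fintype.card α : ℝ)⁻¹)
    (fun _ _ => by positivity) (fun _ => ?_) (fun _ _ _ => by positivity)).trans (le_of_eq ?_)
  · simp [hc.ne']
  · simp only [← Finset.sum_mul, sum_prob_snd, sum_prob, one_mul, Real.logb_inv, neg_neg]

/-- Conditioning reduces entropy. -/
lemma condEntropy_pair_le [Fintype α] [Fintype β] [Fintype γ]
    (f : Ω → α) (g : Ω → β) (h : Ω → γ) :
    condEntropy P f (fun ω => (g ω, h ω)) ≤ condEntropy P f h := by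
  classical
  have hle : ∀ a b c, prob P (fun ω => (f ω, (g ω, h ω))) (a, (b, c)) ≤
      prob P (fun ω => (f ω, h ω)) (a, c) := by
    intro a b c
    simp only [prob_eq_sum, Prod.mk.injEq]
    refine Finset.sum_le_sum fun ω _ => ?_
    have := pmf_toReal_nonneg P ω
    split_ifs <;> tauto
  -- The test distribution is p(a | c), which ignores the value of `g`.
  refine (condEntropy_le_cross P f (fun ω => (g ω, h ω))
    (fun a b => prob P (fun ω => (f ω, h ω)) (a, b.2) / prob P h b.2)
    (fun _ _ => div_nonneg (prob_nonneg P _ _) (prob_nonneg P _ _)) (fun b => ?_)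
    (fun a b hp => ?_)).trans (le_of_eq ?_)
  · rw [← Finset.sum_div, sum_prob_fst]
    exact div_self_le_one _
  · have h1 := hp.trans_le (hle a b.1 b.2)
    exact div_pos h1 (h1.trans_le (prob_pair_le_snd P f h a b.2))
  · rw [condEntropy]
    congr 1
    refine Finset.sum_congr rfl fun a _ => ?_
    rw [Fintype.sum_prod_type, Finset.sum_comm]
    refine Finset.sum_congr rfl fun c _ => ?_
    dsimp only
    rw [← Finset.sum_mul]
    congr 1
    simp only [prob_eq_sum, Prod.mk.injEq]
    rw [Finset.sum_comm]
    refine Finset.sum_congr rfl fun ω _ => ?_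
    by_cases h1 : f ω = a <;> by_cases h2 : h ω = c <;> simp [h1, h2]

/-- Submodularity of entropy. -/
lemma entropy_submodular [Fintype α] [Fintype β] [Fintype γ]
    (f : Ω → α) (g : Ω → β) (h : Ω → γ) :
    entropy P (fun ω => (f ω, (g ω, h ω))) + entropy P h ≤
      entropy P (fun ω => (f ω, h ω)) + entropy P (fun ω => (g ω, h ω)) := by
  have := condEntropy_pair_le P f g h
  rw [condEntropy_eq_sub, condEntropy_eq_sub] at this
  linarith

lemma entropy_le_pair [Fintype α] [Fintype β] (f : Ω → α) (g : Ω → β) :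
    entropy P g ≤ entropy P (fun ω => (f ω, g ω)) := by
  have := condEntropy_nonneg P f g
  rw [condEntropy_eq_sub] at this
  linarith

lemma entropy_pair_le_add_logb_card [Fintype α] [Nonempty α] [Fintype β]
    (f : Ω → α) (g : Ω → β) :
    entropy P (fun ω => (f ω, g ω)) ≤ entropy P g + Real.logb 2 (Fintype.card α) := by
  have := condEntropy_le_logb_card P f g
  rw [condEntropy_eq_sub] at this
  linarith

/-- Conditional subadditivity of entropy over a finite family. -/
lemma entropy_family_le {ι : Type*} {A : ι → Type*} [∀ i, Fintype (A i)] [Fintype β]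
    (f : (i : ι) → Ω → A i) (g : Ω → β) (T : Finset ι) :
    ∀ (_ : Fintype ((i : T) → A i)), entropy P (fun ω => ((fun i : T => f i ω), g ω)) ≤
      entropy P g + ∑ i ∈ T, (entropy P (fun ω => (f i ω, g ω)) - entropy P g) := by
  classical
  induction T using Finset.induction_on with
  | empty =>
    intro _
    rw [entropy_congr P _ g]
    · simp
    · intro ω ω'
      simp only [Prod.mk.injEq, and_iff_right_iff_imp]
      intro _
      ext i
      simp at i
      exact absurd i.2 (by simp)
  | insert j T hj ih =>
    intro _
    have h1 := ih inferInstance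
    have h2 := entropy_submodular P (f j) (fun ω => fun i : T => f i ω) g
    rw [entropy_congr P _ (fun ω => (f j ω, ((fun i : T => f i ω), g ω))), Finset.sum_insert hj]
    · linarith
    · intro ω ω'
      simp only [Prod.mk.injEq, funext_iff, Subtype.forall, Finset.mem_insert, forall_eq_or_imp]
      tauto

/-- Fano's inequality. -/
lemma condEntropy_le_fano [Fintype α] [Nonempty α] [Fintype β] (f : Ω → α) (g : Ω → β)
    (d : β → α) :
    condEntropy P f g ≤
      1 + prob P (fun ω => d (g ω) ≠ f ω) True * Real.logb 2 (Fintype.card α) := by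
  classical
  have hc : (1 : ℝ) ≤ Fintype.card α := by exact_mod_cast Fintype.card_pos
  -- Half point mass at the guess, half uniform: a correct guess costs at most 1 bit, a wrong one 1
  -- + log₂|α| bits.
  set q : α → β → ℝ := fun a b =>
    ((if d b = a then 1 else 0) + (Fintype.card α : ℝ)⁻¹) / 2 with hqdef
  have hqpos : ∀ a b, 0 < q a b := by
    intro a b
    have : (0 : ℝ) ≤ if d b = a then 1 else 0 := by split_ifs <;> norm_num
    simp only [hqdef]
    positivity
  have hcross := condEntropy_le_cross P f g q (fun a b => (hqpos a b).le) (fun b => ?_)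
    (fun a b _ => hqpos a b)
  · refine hcross.trans ?_
    have e1 := sum_prob_mul P (fun ω => (f ω, g ω)) (fun ab => Real.logb 2 (q ab.1 ab.2))
    rw [Fintype.sum_prod_type] at e1
    rw [e1, prob_eq_sum, Finset.sum_mul, ← Finset.sum_neg_distrib, ← sum_pmf_toReal P,
      ← Finset.sum_add_distrib]
    refine Finset.sum_le_sum fun ω _ => ?_
    have hp := pmf_toReal_nonneg P ω
    by_cases hd : d (g ω) = f ω
    · simp only [hd, ne_eq, not_true_eq_false, eq_iff_iff, iff_true, if_false, zero_mul, add_zero]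
      have : Real.logb 2 (1 / 2) ≤ Real.logb 2 (q (f ω) (g ω)) := by
        refine Real.logb_le_logb_of_le (by norm_num) (by norm_num) ?_
        simp only [hqdef, hd, if_true]
        have : 0 ≤ (Fintype.card α : ℝ)⁻¹ := by positivity
        linarith
      rw [one_div, Real.logb_inv, Real.logb_self_eq_one (by norm_num)] at this
      nlinarith
    · simp only [hd, ne_eq, not_false_eq_true, if_true]
      have : Real.logb 2 (q (f ω) (g ω)) = -Real.logb 2 (Fintype.card α) - 1 := by
        simp only [hqdef, hd, if_false, zero_add]
        rw [Real.logb_div (by positivity) (by norm_num), Real.logb_inv,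
          Real.logb_self_eq_one (by norm_num)]
      rw [this]
      nlinarith
  · simp only [hqdef, ← Finset.sum_div, Finset.sum_add_distrib]
    simp [(zero_lt_one.trans_le hc).ne']

/-- A random variable that is a function of the observation has no equivocation. -/
lemma condEntropy_eq_zero [Fintype α] [Fintype β] (f : Ω → α) (g : Ω → β) (d : β → α)
    (h : ∀ ω, (P ω).toReal ≠ 0 → d (g ω) = f ω) : condEntropy P f g = 0 := by
  classical
  refine le_antisymm ?_ (condEntropy_nonneg P f g)
  have hz : ∀ a b, d b ≠ a → prob P (fun ω => (f ω, g ω)) (a, b) = 0 := by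
    intro a b hab
    rw [prob_eq_sum]
    refine Finset.sum_eq_zero fun ω _ => ?_
    by_contra hne
    have h1 : (f ω, g ω) = (a, b) ∧ (P ω).toReal ≠ 0 := by
      constructor <;> by_contra hn <;> simp [hn] at hne
    obtain ⟨h1, h2⟩ := h1
    rw [Prod.mk.injEq] at h1
    exact hab (by rw [← h1.1, ← h1.2, h ω h2])
  refine (condEntropy_le_cross P f g (fun a b => if d b = a then 1 else 0)
    (fun a b => by split_ifs <;> norm_num) (fun b => by simp) (fun a b hp => ?_)).trans
    (le_of_eq ?_)
  · by_cases hd : d b = a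
    · simp [hd]
    · exact absurd (hz a b hd) hp.ne'
  · rw [neg_eq_zero]
    refine Finset.sum_eq_zero fun a _ => Finset.sum_eq_zero fun b _ => ?_
    by_cases hd : d b = a <;> simp [hd]

/-- Independent random variables have no mutual information. -/
lemma mutualInfo_eq_zero [Fintype α] [Fintype β] (f : Ω → α) (g : Ω → β)
    (h : ∀ a b, prob P (fun ω => (f ω, g ω)) (a, b) = prob P f a * prob P g b) :
    mutualInfo P f g = 0 := by
  have : ∀ a b, prob P f a * prob P g b * Real.logb 2 (prob P f a * prob P g b / prob P g b) =
      prob P g b * (prob P f a * Real.logb 2 (prob P f a)) := by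
    intro a b
    by_cases hb : prob P g b = 0
    · simp [hb]
    · rw [mul_div_cancel_right₀ _ hb]
      ring
  rw [mutualInfo, entropy, condEntropy, sub_eq_zero]
  simp only [h, this, ← Finset.sum_mul, sum_prob, one_mul]

end InformationTheory


/-! ### Images of uniform variables. -/

section Uniform

lemma prob_uniform {G α : Type*} [Fintype G] [Nonempty G] [DecidableEq α] (g : G → α) (a : α) :
    prob (PMF.uniformOfFintype G) g a =
      (Finset.univ.filter fun x => g x = a).card / Fintype.card G := by
  classical
  rw [prob_eq_sum, Finset.card_filter]
  push_cast
  rw [Finset.sum_div]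
  refine Finset.sum_congr rfl fun x _ => ?_
  by_cases h : g x = a <;> simp [h]

/-- The fibres are cosets of the kernel, hence equally large. -/
lemma prob_uniform_hom {G A : Type*} [AddCommGroup G] [AddCommGroup A] [Fintype G] [Fintype A]
    (φ : G →+ A) (hφ : Function.Surjective φ) (a : A) :
    prob (PMF.uniformOfFintype G) φ a = (Fintype.card A : ℝ)⁻¹ := by
  classical
  rw [prob_uniform]
  have h : Fintype.card G = Fintype.card A * (Finset.univ.filter fun x => φ x = a).card := by
    rw [← Finset.card_univ, Finset.card_eq_sum_card_fiberwise (f := φ) (t := Finset.univ)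
      (fun _ _ => Finset.mem_coe.2 (Finset.mem_univ _)),
      Finset.sum_congr rfl fun b _ => AddMonoidHom.card_fiber_eq_of_mem_range φ
        (x := b) (y := a) (hφ b) (hφ a)]
    simp
  have hG : (0 : ℝ) < Fintype.card G := by exact_mod_cast Fintype.card_pos
  have hA : (0 : ℝ) < Fintype.card A := by exact_mod_cast Fintype.card_pos
  rw [div_eq_iff hG.ne', h]
  push_cast
  field_simp

lemma entropy_eq_logb_card {Ω A : Type*} [Fintype A] (P : PMF Ω) (f : Ω → A)
    (h : ∀ a, prob P f a = (Fintype.card A : ℝ)⁻¹) (hA : Nonempty A) :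
    entropy P f = Real.logb 2 (Fintype.card A) := by
  have hA : (0 : ℝ) < Fintype.card A := by exact_mod_cast Fintype.card_pos
  simp [entropy, h, Real.logb_inv, hA.ne']

end Uniform

/-! ### Key entropies and the converse for a single scheme. -/

variable {F : Type*} {K : ℕ} {ℓ : Finset (Fin K) → ℕ} {N L : ℕ}

open Classical in
/-- The number of key symbols per block in the `s_U` such that `T U`. -/
noncomputable def keyCount (ℓ : Finset (Fin K) → ℕ) (T : Finset (Fin K) → Prop) : ℕ :=
  ∑ U with U.Nonempty ∧ T U, ℓ U

/-- Values of the key variables `s_U` such that `T U`. -/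
abbrev KeysOn (F : Type*) {K : ℕ} (ℓ : Finset (Fin K) → ℕ) (L : ℕ) (T : Finset (Fin K) → Prop) :
    Type _ :=
  Fin L → (U : {U : Finset (Fin K) // U.Nonempty ∧ T U}) → Fin (ℓ U.1) → F

/-- The key variables `s_U` such that `T U`. -/
def keysOn (T : Finset (Fin K) → Prop) (s : Keys F ℓ L) : KeysOn F ℓ L T :=
  fun l U => s l ⟨U.1, U.2.1⟩

lemma keysOn_surjective [Zero F] (T : Finset (Fin K) → Prop) :
    Function.Surjective (keysOn T : Keys F ℓ L → KeysOn F ℓ L T) := by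
  classical
  intro z
  refine ⟨fun l U => if h : T U.1 then z l ⟨U.1, U.2, h⟩ else 0, ?_⟩
  funext l U
  simp [keysOn, U.2.2]

/-- Entropy sees only the induced partition, so this and `receiverKey_eq_iff` allow tuples of
receiver keys to be replaced by one `keysOn`. -/
lemma keysOn_eq_iff (T : Finset (Fin K) → Prop) (s s' : Keys F ℓ L) :
    keysOn T s = keysOn T s' ↔ ∀ U (hU : U.Nonempty), T U → ∀ l i, s l ⟨U, hU⟩ i = s' l ⟨U, hU⟩ i := by
  simp only [keysOn, funext_iff, Subtype.forall]
  exact ⟨fun h U hU hT l i => h l U ⟨hU, hT⟩ i, fun h l U hU i => h U hU.1 hU.2 l i⟩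

lemma receiverKey_eq_iff (k : Fin K) (s s' : Keys F ℓ L) :
    receiverKey k s = receiverKey k s' ↔
      ∀ U (hU : U.Nonempty), k ∈ U → ∀ l i, s l ⟨U, hU⟩ i = s' l ⟨U, hU⟩ i := by
  simp only [receiverKey, funext_iff, Subtype.forall]
  exact ⟨fun h U hU hT l i => h l U hT i, fun h l U hU i => h U ⟨k, hU⟩ hU l i⟩

lemma logb_card_keysOn [Fintype F] [Nonempty F] (T : Finset (Fin K) → Prop)
    [Fintype (KeysOn F ℓ L T)] :
    Real.logb 2 (Fintype.card (KeysOn F ℓ L T)) =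
      L * keyCount ℓ T * Real.logb 2 (Fintype.card F) := by
  classical
  have h : Fintype.card (KeysOn F ℓ L T) = Fintype.card F ^ (L * keyCount ℓ T) := by
    rw [← Nat.card_eq_fintype_card, ← Nat.card_eq_fintype_card (α := F)]
    simp only [Nat.card_pi, Finset.prod_const, Finset.card_univ, Fintype.card_fin, keyCount]
    rw [Finset.prod_pow_eq_pow_sum, ← pow_mul, mul_comm L]
    congr 2
    exact (Finset.sum_subtype _ (fun U => by simp) (fun U => ℓ U)).symm
  rw [h]
  push_cast
  rw [Real.logb_pow]
  push_cast
  ring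

/-- The second summand plays the role of a conditional entropy such as H(Z_k | Z_e). -/
lemma keyCount_or (S T : Finset (Fin K) → Prop) :
    keyCount ℓ (fun U => S U ∨ T U) = keyCount ℓ T + keyCount ℓ (fun U => S U ∧ ¬ T U) := by
  classical
  simp only [keyCount, Finset.sum_filter, ← Finset.sum_add_distrib]
  refine Finset.sum_congr rfl fun U _ => ?_
  by_cases hS : S U <;> by_cases hT : T U <;> simp [hS, hT]

namespace Scheme

variable [Fintype F]

/-- The randomness of the encoder integrates out, so message and keys stay jointly uniform whatever
the encoder is. -/
lemma prob_law_source [Nonempty F] {α : Type*} (c : Scheme F ℓ N L)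
    (g : (Fin c.LW → F) × Keys F ℓ L → α) (a : α) :
    prob c.law (fun ω => g (ω.1, ω.2.1)) a =
      prob (PMF.uniformOfFintype ((Fin c.LW → F) × Keys F ℓ L)) g a := by
  unfold prob law
  rw [PMF.map_bind]
  simp only [PMF.map_comp]
  have h : ∀ ws : (Fin c.LW → F) × Keys F ℓ L,
      PMF.map ((fun ω : c.Sample => g (ω.1, ω.2.1)) ∘ fun x => (ws.1, ws.2, x))
        (c.enc ws.1 ws.2) = PMF.pure (g ws) := fun ws =>
    PMF.map_const (c.enc ws.1 ws.2) (g ws)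
  simp only [h]
  rfl

variable [Field F]

lemma entropy_law_source {A : Type*} [AddCommGroup A] [Fintype A] (c : Scheme F ℓ N L)
    (φ : (Fin c.LW → F) × Keys F ℓ L →+ A) (hφ : Function.Surjective φ) :
    entropy c.law (fun ω => φ (ω.1, ω.2.1)) = Real.logb 2 (Fintype.card A) :=
  entropy_eq_logb_card _ _ (fun a => by
    rw [prob_law_source c (fun x => φ x) a]
    exact prob_uniform_hom φ hφ a) ⟨0⟩

lemma entropy_msg (c : Scheme F ℓ N L) :
    entropy c.law c.msg = c.LW * Real.logb 2 (Fintype.card F) := by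
  have := c.entropy_law_source (AddMonoidHom.fst _ _) Prod.fst_surjective
  refine this.trans ?_
  simp [Real.logb_pow]

lemma entropy_keysOn (c : Scheme F ℓ N L) (T : Finset (Fin K) → Prop)
    [Fintype (KeysOn F ℓ L T)] :
    entropy c.law (fun ω => keysOn T ω.2.1) =
      L * keyCount ℓ T * Real.logb 2 (Fintype.card F) := by
  rw [← logb_card_keysOn]
  refine c.entropy_law_source (A := KeysOn F ℓ L T)
    ⟨⟨fun x => keysOn T x.2, rfl⟩, fun _ _ => rfl⟩ ?_
  exact (keysOn_surjective T).comp Prod.snd_surjective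

lemma entropy_msg_keysOn (c : Scheme F ℓ N L) (T : Finset (Fin K) → Prop)
    [Fintype (KeysOn F ℓ L T)] :
    entropy c.law (fun ω => (c.msg ω, keysOn T ω.2.1)) =
      c.LW * Real.logb 2 (Fintype.card F) +
      L * keyCount ℓ T * Real.logb 2 (Fintype.card F) := by
  have := c.entropy_law_source (A := (Fin c.LW → F) × KeysOn F ℓ L T)
    ⟨⟨fun x => (x.1, keysOn T x.2), rfl⟩, fun _ _ => rfl⟩
    (Function.surjective_id.prodMap (keysOn_surjective T))
  refine this.trans ?_
  rw [← logb_card_keysOn, Fintype.card_prod]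
  push_cast
  rw [Real.logb_mul]
  · simp [Real.logb_pow]
  · exact_mod_cast Fintype.card_ne_zero
  · exact_mod_cast Fintype.card_ne_zero

lemma entropy_receiverKey (c : Scheme F ℓ N L) (k : Fin K) :
    entropy c.law (fun ω => receiverKey k ω.2.1) =
      L * keyCount ℓ (k ∈ ·) * Real.logb 2 (Fintype.card F) := by
  classical
  rw [← c.entropy_keysOn]
  refine entropy_congr _ _ _ fun ω ω' => ?_
  rw [receiverKey_eq_iff, keysOn_eq_iff]

lemma entropy_receiverKey_pair (c : Scheme F ℓ N L) (k e : Fin K) :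
    entropy c.law (fun ω => (receiverKey k ω.2.1, receiverKey e ω.2.1)) =
      L * keyCount ℓ (fun U => k ∈ U ∨ e ∈ U) * Real.logb 2 (Fintype.card F) := by
  classical
  rw [← c.entropy_keysOn]
  refine entropy_congr _ _ _ fun ω ω' => ?_
  rw [Prod.mk.injEq, receiverKey_eq_iff, receiverKey_eq_iff, keysOn_eq_iff]
  exact ⟨fun h U hU hT => hT.elim (h.1 U hU) (h.2 U hU),
    fun h => ⟨fun U hU hk => h U hU (.inl hk), fun U hU hk => h U hU (.inr hk)⟩⟩

/-- The residual uncertainty about the key of a legitimate receiver given the message and what an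
eavesdropper observes. -/
lemma key_equivocation_le (c : Scheme F ℓ N L) (k e : Fin K) :
    entropy c.law (fun ω => (receiverKey k ω.2.1, (c.msg ω, c.view e ω))) -
        entropy c.law (fun ω => (c.msg ω, c.view e ω)) ≤
      c.equivocation k + c.leakage e - c.LW * Real.logb 2 (Fintype.card F) +
        L * keyCount ℓ (fun U => k ∈ U ∧ e ∉ U) * Real.logb 2 (Fintype.card F) := by
  -- `h1` says H(W | X,Z_k,Z_e) ≤ H(W | X,Z_k), and `h2` says H(Z_k | X,Z_e) ≤ H(Z_k | Z_e).
  have h1 := entropy_submodular c.law c.msg (fun ω => receiverKey e ω.2.1) (c.view k)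
  have h2 := entropy_submodular c.law (fun ω => ω.2.2) (fun ω => receiverKey k ω.2.1)
    (fun ω => receiverKey e ω.2.1)
  have e1 : entropy c.law (fun ω => (c.msg ω, (receiverKey e ω.2.1, c.view k ω))) =
      entropy c.law (fun ω => (receiverKey k ω.2.1, (c.msg ω, c.view e ω))) := by
    refine entropy_congr _ _ _ fun ω ω' => ?_
    simp only [view, Prod.mk.injEq]
    tauto
  have e2 : entropy c.law (fun ω => (receiverKey e ω.2.1, c.view k ω)) =
      entropy c.law (fun ω => (ω.2.2, (receiverKey k ω.2.1, receiverKey e ω.2.1))) := by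
    refine entropy_congr _ _ _ fun ω ω' => ?_
    simp only [view, Prod.mk.injEq]
    tauto
  have e3 : entropy c.law (fun ω => (ω.2.2, receiverKey e ω.2.1)) = entropy c.law (c.view e) := rfl
  rw [e1, e2] at h1
  rw [e3, c.entropy_receiverKey_pair, c.entropy_receiverKey, keyCount_or] at h2
  rw [equivocation, leakage, mutualInfo, condEntropy_eq_sub, condEntropy_eq_sub, c.entropy_msg]
  push_cast at h2
  linarith

lemma equivocation_nonneg (c : Scheme F ℓ N L) (k : Fin K) : 0 ≤ c.equivocation k :=
  condEntropy_nonneg _ _ _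

/-- The residual entropy in `key_equivocation_le` cannot be negative. -/
lemma msg_length_le (c : Scheme F ℓ N L) (k e : Fin K) :
    c.LW * Real.logb 2 (Fintype.card F) ≤
      L * keyCount ℓ (fun U => k ∈ U ∧ e ∉ U) * Real.logb 2 (Fintype.card F) +
        c.equivocation k + c.leakage e := by
  have h1 := c.key_equivocation_le k e
  have h2 := entropy_le_pair c.law (fun ω => receiverKey k ω.2.1) (fun ω => (c.msg ω, c.view e ω))
  linarith

lemma equivocation_le_fano (c : Scheme F ℓ N L) (k : {k : Fin K // k.val < N}) :
    c.equivocation k.1 ≤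
      1 + c.errorProb k * (c.LW * Real.logb 2 (Fintype.card F)) := by
  have := condEntropy_le_fano c.law c.msg (c.view k.1) (fun v => c.dec k v.1 v.2)
  refine this.trans (le_of_eq ?_)
  simp [errorProb, Real.logb_pow]

/-- The transmit signal has to resolve all the keys that are known to a legitimate receiver and
not to the eavesdropper, up to their residual uncertainty. -/
lemma key_length_le (c : Scheme F ℓ N L) (e : Fin K) :
    L * keyCount ℓ (fun U => (∃ k ∈ U, k.val < N) ∧ e ∉ U) * Real.logb 2 (Fintype.card F) ≤
      c.LX * Real.logb 2 (Fintype.card F) + ∑ k : Fin K with k.val < N,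
        (c.equivocation k + c.leakage e - c.LW * Real.logb 2 (Fintype.card F) +
          L * keyCount ℓ (fun U => k ∈ U ∧ e ∉ U) * Real.logb 2 (Fintype.card F)) := by
  classical
  set T : Finset (Fin K) := Finset.univ.filter fun k => k.val < N with hT
  have h1 := entropy_family_le c.law (fun k ω => receiverKey k ω.2.1)
    (fun ω => (c.msg ω, c.view e ω)) T inferInstance
  have h2 := Finset.sum_le_sum fun k (_ : k ∈ T) => c.key_equivocation_le k e
  have h3 := entropy_pair_le_add_logb_card c.law (fun ω => ω.2.2)
    (fun ω => (c.msg ω, receiverKey e ω.2.1))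
  have e3 : entropy c.law (fun ω => (ω.2.2, (c.msg ω, receiverKey e ω.2.1))) =
      entropy c.law (fun ω => (c.msg ω, c.view e ω)) := by
    refine entropy_congr _ _ _ fun ω ω' => ?_
    simp only [view, Prod.mk.injEq]
    tauto
  have e4 : entropy c.law (fun ω => (c.msg ω, receiverKey e ω.2.1)) =
      c.LW * Real.logb 2 (Fintype.card F) +
        L * keyCount ℓ (e ∈ ·) * Real.logb 2 (Fintype.card F) := by
    rw [← c.entropy_msg_keysOn]
    refine entropy_congr _ _ _ fun ω ω' => ?_
    rw [Prod.mk.injEq, Prod.mk.injEq, receiverKey_eq_iff, keysOn_eq_iff]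
  -- Message and keys of all legitimate receivers and of `e` have an entropy known exactly.
  -- Adjoining X yields the joint variable bounded by `h1` and `h3`.
  have h5 := entropy_le_pair c.law (fun ω => ω.2.2)
    (fun ω => (c.msg ω, keysOn (fun U => (∃ k ∈ U, k.val < N) ∨ e ∈ U) ω.2.1))
  have e5 : entropy c.law (fun ω => (ω.2.2,
        (c.msg ω, keysOn (fun U => (∃ k ∈ U, k.val < N) ∨ e ∈ U) ω.2.1))) =
      entropy c.law (fun ω => ((fun k : T => receiverKey k.1 ω.2.1), (c.msg ω, c.view e ω))) := by
    refine entropy_congr _ _ _ fun ω ω' => ?_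
    simp only [view, Prod.mk.injEq, funext_iff (f := fun k : T => receiverKey k.1 ω.2.1),
      receiverKey_eq_iff, keysOn_eq_iff, Subtype.forall]
    constructor
    · rintro ⟨hx, hw, hk⟩
      exact ⟨fun k hkT U hU hkU => hk U hU (.inl ⟨k, hkU, by simpa [hT] using hkT⟩), hw, hx,
        fun U hU he => hk U hU (.inr he)⟩
    · rintro ⟨hk, hw, hx, he⟩
      refine ⟨hx, hw, fun U hU => ?_⟩
      rintro (⟨k, hkU, hkN⟩ | heU)
      · exact hk k (by simpa [hT] using hkN) U hU hkU
      · exact he U hU heU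
  rw [e5, c.entropy_msg_keysOn, keyCount_or] at h5
  rw [e3, e4] at h3
  have e6 : Real.logb 2 (Fintype.card (Fin c.LX → F)) = c.LX * Real.logb 2 (Fintype.card F) := by
    simp [Real.logb_pow]
  rw [e6] at h3
  push_cast at h5
  linarith

end Scheme


/-! ### Maximum distance separable codes. -/

open Polynomial in
/-- Reed–Solomon codes. -/
lemma exists_mds_code_field {E J : Type*} [Field E] [Fintype E] [Fintype J]
    (hJ : Fintype.card J ≤ Fintype.card E) (R : ℕ) :
    ∃ D : (Fin R → E) → J → E, ∀ S : Finset J, R ≤ S.card →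
      ∀ w w', (∀ j ∈ S, D w j = D w' j) → w = w' := by
  obtain ⟨x⟩ := Function.Embedding.nonempty_of_card_le hJ
  have hdeg : ∀ w : Fin R → E, (∑ r : Fin R, C (w r) * X ^ (r : ℕ)).degree < (R : WithBot ℕ) :=
    fun w => degree_sum_fin_lt w
  refine ⟨fun w j => (∑ r : Fin R, C (w r) * X ^ (r : ℕ)).eval (x j), fun S hS w w' h => ?_⟩
  have hR : (R : WithBot ℕ) ≤ S.card := by exact_mod_cast hS
  -- Polynomials of degree below `R` that agree at `R` or more points coincide.
  have h1 := eq_of_degrees_lt_of_eval_index_eq S (x.injective.injOn (s := S))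
    ((hdeg w).trans_le hR) ((hdeg w').trans_le hR) h
  have hcoeff : ∀ (w : Fin R → E) (r : Fin R),
      (∑ r : Fin R, C (w r) * X ^ (r : ℕ)).coeff r = w r := by
    intro w r
    simp [coeff_X_pow, Fin.val_inj]
  funext r
  rw [← hcoeff w r, h1, hcoeff w' r]

/-- Maximum distance separable codes over the alphabet `F ^ L`. -/
lemma exists_mds_code {F J : Type*} [Field F] [Fintype F] [Fintype J] {L : ℕ} (hL : L ≠ 0)
    (hJ : Fintype.card J ≤ Fintype.card F ^ L) (R : ℕ) :
    ∃ D : (Fin (R * L) → F) → J → Fin L → F, ∀ S : Finset J, R ≤ S.card →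
      ∀ w w', (∀ j ∈ S, D w j = D w' j) → w = w' := by
  have hcard : Fintype.card (Fin L → F) = Fintype.card F ^ L := by simp
  -- The alphabet gets a new name so that a field structure, available by cardinality, does not
  -- clash with the pointwise operations. The code need not be linear over `F`.
  obtain ⟨E, hE⟩ : ∃ E : Type _, E = (Fin L → F) := ⟨_, rfl⟩
  have : Fintype E := hE ▸ inferInstance
  have hcardE : Fintype.card E = Fintype.card F ^ L := by
    rw [← hcard]
    exact Fintype.card_congr (Equiv.cast hE)
  obtain ⟨hfield⟩ := Fintype.nonempty_field_iff.2
    (hcardE ▸ (Fintype.isPrimePow_card_of_field (α := F)).pow hL : IsPrimePow (Fintype.card E))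
  obtain ⟨D, hD⟩ := exists_mds_code_field (E := E) (J := J) (hcardE ▸ hJ) R
  let φ : (Fin (R * L) → F) ≃ (Fin R → E) :=
    ((Equiv.arrowCongr finProdFinEquiv.symm (Equiv.refl F)).trans
      (Equiv.curry (Fin R) (Fin L) F)).trans (Equiv.arrowCongr (Equiv.refl _) (Equiv.cast hE.symm))
  refine ⟨fun w j => Equiv.cast hE (D (φ w) j), fun S hS w w' h => φ.injective ?_⟩
  exact hD S hS _ _ fun j hj => (Equiv.cast hE).injective (h j hj)

/-! ### Deterministic encoders: zero error and zero leakage. -/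

namespace Scheme

variable {F : Type*} [Field F] [Fintype F] {K : ℕ} {ℓ : Finset (Fin K) → ℕ} {N L LW LX : ℕ}

section Deterministic

variable (c : Scheme F ℓ N L) (f : (Fin c.LW → F) → Keys F ℓ L → (Fin c.LX → F))

lemma law_of_deterministic (hf : ∀ w s, c.enc w s = PMF.pure (f w s)) :
    c.law = (PMF.uniformOfFintype ((Fin c.LW → F) × Keys F ℓ L)).map
      fun ws => (ws.1, ws.2, f ws.1 ws.2) := by
  simp only [law, hf, PMF.pure_map]
  rfl

lemma prob_law_of_deterministic (hf : ∀ w s, c.enc w s = PMF.pure (f w s)) {α : Type*}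
    (g : c.Sample → α) (a : α) :
    prob c.law g a = prob (PMF.uniformOfFintype ((Fin c.LW → F) × Keys F ℓ L))
      (fun ws => g (ws.1, ws.2, f ws.1 ws.2)) a := by
  rw [law_of_deterministic c f hf, prob, PMF.map_comp]
  rfl

lemma signal_eq_of_law_ne_zero (hf : ∀ w s, c.enc w s = PMF.pure (f w s)) (ω : c.Sample)
    (h : (c.law ω).toReal ≠ 0) : ω.2.2 = f ω.1 ω.2.1 := by
  have h1 : ω ∈ c.law.support := by
    rw [PMF.mem_support_iff]
    intro h0
    simp [h0] at h
  rw [law_of_deterministic c f hf, PMF.mem_support_map_iff] at h1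
  obtain ⟨ws, -, rfl⟩ := h1
  rfl

lemma errorProb_eq_zero (hf : ∀ w s, c.enc w s = PMF.pure (f w s))
    (k : {k : Fin K // k.val < N}) (h : ∀ w s, c.dec k (f w s) (receiverKey k.1 s) = w) :
    c.errorProb k = 0 := by
  classical
  rw [errorProb, prob_eq_sum]
  refine Finset.sum_eq_zero fun ω _ => ?_
  by_cases hω : (c.law ω).toReal = 0
  · rw [hω, ite_self]
  · rw [if_neg]
    simp only [view, msg, signal_eq_of_law_ne_zero c f hf ω hω, h, ne_eq, not_true_eq_false,
      eq_iff_iff, iff_true, not_false_eq_true]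

lemma equivocation_eq_zero (hf : ∀ w s, c.enc w s = PMF.pure (f w s))
    (k : {k : Fin K // k.val < N}) (h : ∀ w s, c.dec k (f w s) (receiverKey k.1 s) = w) :
    c.equivocation k.1 = 0 :=
  condEntropy_eq_zero _ _ _ (fun v => c.dec k v.1 v.2) fun ω hω => by
    simp only [view, msg, signal_eq_of_law_ne_zero c f hf ω hω, h]

/-- If changing the message can be compensated by a shift of the keys that the eavesdropper does
not see, then nothing leaks. -/
lemma leakage_eq_zero (hf : ∀ w s, c.enc w s = PMF.pure (f w s)) (e : Fin K)
    (h : ∀ w w', ∃ t : Keys F ℓ L, ∀ s, f w (s + t) = f w' s ∧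
      receiverKey e (s + t) = receiverKey e s) :
    c.leakage e = 0 := by
  classical
  let cnt : (Fin c.LW → F) → (Fin c.LX → F) × ReceiverKey F ℓ L e → ℕ := fun w v =>
    (Finset.univ.filter fun s : Keys F ℓ L => (f w s, receiverKey e s) = v).card
  -- Translation by `t` is a bijection between the keys compatible with a view under the two
  -- messages.
  have hcnt : ∀ w w' v, cnt w v = cnt w' v := by
    intro w w' v
    obtain ⟨t, ht⟩ := h w w'
    symm
    refine Finset.card_bij (fun s _ => s + t) ?_ (fun _ _ _ _ h => add_right_cancel h) ?_
    · intro s hs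
      simpa [(ht s).1, (ht s).2] using hs
    · intro s hs
      refine ⟨s - t, ?_, sub_add_cancel s t⟩
      have h1 := ht (s - t)
      rw [sub_add_cancel] at h1
      simpa [← h1.1, ← h1.2] using hs
  have hpair : ∀ w v, prob c.law (fun ω => (c.msg ω, c.view e ω)) (w, v) =
      cnt w v / Fintype.card ((Fin c.LW → F) × Keys F ℓ L) := by
    intro w v
    rw [prob_law_of_deterministic c f hf, prob_uniform]
    congr 2
    refine Finset.card_bij' (fun x _ => x.2) (fun s _ => (w, s)) ?_ ?_ ?_ ?_
    · rintro ⟨w', s⟩ hs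
      simp only [Finset.mem_filter, Finset.mem_univ, true_and, Prod.mk.injEq, msg, view] at hs ⊢
      obtain ⟨rfl, hv⟩ := hs
      exact hv
    · intro s hs
      simpa [msg, view] using hs
    · rintro ⟨w', s⟩ hs
      simp only [Finset.mem_filter, Finset.mem_univ, true_and, Prod.mk.injEq, msg, view] at hs
      rw [hs.1]
    · intro s _
      rfl
  have hmsg : ∀ w, prob c.law c.msg w = (Fintype.card (Fin c.LW → F) : ℝ)⁻¹ := by
    intro w
    rw [← prob_uniform_hom (AddMonoidHom.fst (Fin c.LW → F) (Keys F ℓ L)) Prod.fst_surjective w]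
    exact prob_law_of_deterministic c f hf _ _
  refine mutualInfo_eq_zero _ _ _ fun w v => ?_
  have hW : (0 : ℝ) < Fintype.card (Fin c.LW → F) := by exact_mod_cast Fintype.card_pos
  have hv : prob c.law (c.view e) v = Fintype.card (Fin c.LW → F) *
      (cnt w v / Fintype.card ((Fin c.LW → F) × Keys F ℓ L)) := by
    rw [← sum_prob_fst _ c.msg]
    rw [Finset.sum_congr rfl fun w' _ => (hpair w' v).trans (by rw [hcnt w' w])]
    rw [Finset.sum_const, nsmul_eq_mul]
    rfl
  rw [hmsg, hv, hpair, inv_mul_cancel_left₀ hW.ne']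

end Deterministic

open Classical in
/-- The scheme with a given deterministic encoder, whose decoders search for a consistent
message. -/
noncomputable abbrev ofEncoder (N : ℕ) (f : (Fin LW → F) → Keys F ℓ L → (Fin LX → F)) :
    Scheme F ℓ N L where
  LW := LW
  LX := LX
  enc w s := PMF.pure (f w s)
  dec k x z := if h : ∃ w s, f w s = x ∧ receiverKey k.1 s = z then h.choose else 0

lemma ofEncoder_dec (f : (Fin LW → F) → Keys F ℓ L → (Fin LX → F)) (k : {k : Fin K // k.val < N})
    (h : ∀ w w' s s', f w s = f w' s' → receiverKey k.1 s = receiverKey k.1 s' → w = w')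
    (w : Fin LW → F) (s : Keys F ℓ L) :
    (ofEncoder N f).dec k (f w s) (receiverKey k.1 s) = w := by
  have hex : ∃ w' s', f w' s' = f w s ∧ receiverKey k.1 s' = receiverKey k.1 s := ⟨w, s, rfl, rfl⟩
  have hdec : (ofEncoder N f).dec k (f w s) (receiverKey k.1 s) = hex.choose := dif_pos hex
  obtain ⟨s', hs1, hs2⟩ := hex.choose_spec
  exact hdec.trans (h _ _ _ _ hs1 hs2)

end Scheme


/-! ### The key masks and their invisible shifts. -/

section Construction

variable {F : Type*} [Field F] {K : ℕ} {ℓ : Finset (Fin K) → ℕ} {N L : ℕ}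

/-- The symbol of `s_U` with a given index, `0` if there is none. -/
def keySymbol (s : Keys F ℓ L) (l : Fin L) (U : Finset (Fin K)) (i : ℕ) : F :=
  if h : U.Nonempty ∧ i < ℓ U then s l ⟨U, h.1⟩ ⟨i, h.2⟩ else 0

/-- The key symbols `(U, i)` known to a legitimate receiver and not to the eavesdropper `e₀`; they
index the transmit signal. -/
abbrev SignalIndex (ℓ : Finset (Fin K) → ℕ) (N : ℕ) (e₀ : Fin K) : Type :=
  {j : (U : Finset (Fin K)) × Fin (ℓ U) // (∃ k ∈ j.1, k.val < N) ∧ e₀ ∉ j.1}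

/-- The eavesdroppers in `U`. -/
def eaves (N : ℕ) (U : Finset (Fin K)) : Finset (Fin K) := U.filter fun e => N ≤ e.val

/-- Replace `e` by `e'` in `U`. -/
def swapIn (U : Finset (Fin K)) (e e' : Fin K) : Finset (Fin K) := insert e' (U.erase e)

/-- This is what lets the symmetric setting give s_U and the swapped key equally many symbols. -/
lemma card_swapIn {U : Finset (Fin K)} {e e' : Fin K} (he : e ∈ U) (he' : e' ∉ U) :
    (swapIn U e e').card = U.card := by
  rw [swapIn, Finset.card_insert_of_notMem (fun h => he' (Finset.mem_of_mem_erase h)),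
    Finset.card_erase_add_one he]

lemma mem_swapIn {U : Finset (Fin K)} {e e' k : Fin K} :
    k ∈ swapIn U e e' ↔ k = e' ∨ (k ≠ e ∧ k ∈ U) := by
  rw [swapIn, Finset.mem_insert, Finset.mem_erase]

lemma swapIn_swapIn {U : Finset (Fin K)} {a b c : Fin K} (hb : b ∉ U) :
    swapIn (swapIn U a b) b c = swapIn U a c := by
  ext k
  simp only [mem_swapIn]
  by_cases hkb : k = b
  · subst hkb
    tauto
  · tauto

lemma swapIn_self {U : Finset (Fin K)} {a : Fin K} (ha : a ∈ U) : swapIn U a a = U :=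
  Finset.insert_erase ha

/-- The part of the transmit signal that depends on the keys. -/
def keyCombination (N : ℕ) (e₀ : Fin K) (s : Keys F ℓ L) (j : SignalIndex ℓ N e₀) (l : Fin L) : F :=
  keySymbol s l j.1.1 j.1.2 + ∑ e ∈ eaves N j.1.1, keySymbol s l (swapIn j.1.1 e e₀) j.1.2

lemma keyCombination_add (e₀ : Fin K) (s t : Keys F ℓ L) :
    keyCombination N e₀ (s + t) = keyCombination N e₀ s + keyCombination N e₀ t := by
  have h : ∀ l U i, keySymbol (s + t) l U i = keySymbol s l U i + keySymbol t l U i := by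
    intro l U i
    unfold keySymbol
    split_ifs <;> simp
  funext j l
  simp only [keyCombination, h, Finset.sum_add_distrib, Pi.add_apply]
  ring

lemma keySymbol_congr {k : Fin K} {s s' : Keys F ℓ L} (h : receiverKey k s = receiverKey k s')
    {U : Finset (Fin K)} (hU : k ∈ U) (l : Fin L) (i : ℕ) :
    keySymbol s l U i = keySymbol s' l U i := by
  unfold keySymbol
  split_ifs with hi
  · exact (receiverKey_eq_iff k s s').1 h U hi.1 hU l ⟨i, hi.2⟩
  · rfl

/-- Only eavesdroppers are swapped out, so the legitimate `k` belongs to the index set of every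
summand. -/
lemma keyCombination_congr {k e₀ : Fin K} (hk : k.val < N) {s s' : Keys F ℓ L}
    (h : receiverKey k s = receiverKey k s') {j : SignalIndex ℓ N e₀} (hj : k ∈ j.1.1)
    (l : Fin L) : keyCombination N e₀ s j l = keyCombination N e₀ s' j l := by
  rw [keyCombination, keyCombination, keySymbol_congr h hj]
  congr 1
  refine Finset.sum_congr rfl fun e he => keySymbol_congr h ?_ _ _
  rw [mem_swapIn]
  refine .inr ⟨?_, hj⟩
  rintro rfl
  exact absurd (Finset.mem_filter.1 he).2 (not_le.2 hk)

/-- Extension by zero of a family indexed by the transmit symbols. -/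
noncomputable def extendSignal {e₀ : Fin K} (δ : SignalIndex ℓ N e₀ → Fin L → F) (l : Fin L)
    (U : Finset (Fin K)) (i : ℕ) : F :=
  open Classical in
  -- The zero default covers swapped sets without legitimate members or containing `e₀`.
  if h : ((∃ k ∈ U, k.val < N) ∧ e₀ ∉ U) ∧ i < ℓ U then δ ⟨⟨U, ⟨i, h.2⟩⟩, h.1⟩ l else 0

lemma extendSignal_apply {e₀ : Fin K} (δ : SignalIndex ℓ N e₀ → Fin L → F) (l : Fin L)
    (j : SignalIndex ℓ N e₀) : extendSignal δ l j.1.1 j.1.2 = δ j l :=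
  dif_pos ⟨j.2, j.1.2.2⟩

lemma extendSignal_eq_zero {e₀ : Fin K} (δ : SignalIndex ℓ N e₀ → Fin L → F) (l : Fin L)
    {U : Finset (Fin K)} (hU : e₀ ∈ U) (i : ℕ) : extendSignal δ l U i = 0 :=
  dif_neg fun h => h.1.2 hU

/-- Keys invisible to the eavesdropper `e` that produce a given key combination. -/
noncomputable def keyShift {e₀ : Fin K} (δ : SignalIndex ℓ N e₀ → Fin L → F) (e : Fin K) :
    Keys F ℓ L :=
  -- A set V containing `e₀` but not `e` is paired with V − e₀ + e and carries the target there. A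
  -- set avoiding both carries its own target minus what those keys contribute to its mask.
  fun l U i => if e ∈ U.1 then 0 else
    if e₀ ∈ U.1 then extendSignal δ l (swapIn U.1 e₀ e) i else
      extendSignal δ l U.1 i - ∑ a ∈ eaves N U.1, extendSignal δ l (swapIn U.1 a e) i

lemma receiverKey_add_keyShift {e₀ : Fin K} (δ : SignalIndex ℓ N e₀ → Fin L → F) (e : Fin K)
    (s : Keys F ℓ L) : receiverKey e (s + keyShift δ e) = receiverKey e s := by
  rw [receiverKey_eq_iff]
  intro U hU he l i
  simp [keyShift, he]

/-- If `e ∈ U`, the only summand not known to `e` comes from swapping out `e` itself, and it equals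
the target. If `e ∉ U`, the correction in the shift of s_U cancels the swapped summands. For `e =
e₀` these all vanish. -/
lemma keyCombination_keyShift
    (hsym : ∀ U V : Finset (Fin K), U.Nonempty → V.Nonempty → U.card = V.card → ℓ U = ℓ V)
    {e₀ : Fin K} (δ : SignalIndex ℓ N e₀ → Fin L → F) {e : Fin K} (he : N ≤ e.val) :
    keyCombination N e₀ (keyShift δ e) = δ := by
  funext j l
  obtain ⟨⟨U, i⟩, hU, h0⟩ := j
  have hne : U.Nonempty := hU.imp fun k hk => hk.1
  have hswap : ∀ a ∈ eaves N U, (swapIn U a e₀).Nonempty ∧ i.val < ℓ (swapIn U a e₀) := by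
    intro a ha
    have h1 : (swapIn U a e₀).Nonempty := ⟨e₀, mem_swapIn.2 (.inl rfl)⟩
    refine ⟨h1, i.2.trans_eq (hsym _ _ hne h1 ?_)⟩
    exact (card_swapIn (Finset.mem_filter.1 ha).1 h0).symm
  have happ := extendSignal_apply δ l ⟨⟨U, i⟩, hU, h0⟩
  simp only at happ
  rw [keyCombination, ← happ]
  simp only
  rw [keySymbol, dif_pos ⟨hne, i.2⟩]
  by_cases heU : e ∈ U
  · have hee : e ≠ e₀ := fun h => h0 (h ▸ heU)
    have heav : e ∈ eaves N U := Finset.mem_filter.2 ⟨heU, he⟩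
    rw [keyShift, if_pos heU, zero_add, Finset.sum_eq_single_of_mem e heav]
    · rw [keySymbol, dif_pos (hswap e heav), keyShift, if_neg, if_pos,
        swapIn_swapIn h0, swapIn_self heU]
      · exact mem_swapIn.2 (.inl rfl)
      · rw [mem_swapIn]
        tauto
    · intro a ha hae
      rw [keySymbol, dif_pos (hswap a ha), keyShift, if_pos]
      exact mem_swapIn.2 (.inr ⟨hae.symm, heU⟩)
  · rw [keyShift, if_neg heU, if_neg h0]
    have hterm : ∀ a ∈ eaves N U, keySymbol (keyShift δ e) l (swapIn U a e₀) i =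
        extendSignal δ l (swapIn U a e) i := by
      intro a ha
      rw [keySymbol, dif_pos (hswap a ha), keyShift]
      by_cases hee : e = e₀
      · subst hee
        have hmem : e ∈ swapIn U a e := mem_swapIn.2 (.inl rfl)
        rw [if_pos hmem, extendSignal_eq_zero δ l hmem]
      · rw [if_neg, if_pos, swapIn_swapIn h0]
        · exact mem_swapIn.2 (.inl rfl)
        · rw [mem_swapIn]
          tauto
    rw [Finset.sum_congr rfl hterm]
    exact sub_add_cancel _ _

end Construction

/-! ### Counting key symbols. -/

section Counting

variable {K : ℕ} {ℓ : Finset (Fin K) → ℕ} {N : ℕ}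

lemma card_filter_signalIndex (e₀ : Fin K) (T : Finset (Fin K) → Prop) [DecidablePred T] :
    (Finset.univ.filter fun j : SignalIndex ℓ N e₀ => T j.1.1).card =
      keyCount ℓ (fun U => T U ∧ (∃ k ∈ U, k.val < N) ∧ e₀ ∉ U) := by
  classical
  rw [Finset.card_filter, ← Finset.sum_subtype (Finset.univ.filter
      fun j : (U : Finset (Fin K)) × Fin (ℓ U) => (∃ k ∈ j.1, k.val < N) ∧ e₀ ∉ j.1)
      (fun j => by simp) (fun j => if T j.1 then 1 else 0),
    Finset.sum_filter, Fintype.sum_sigma, keyCount, Finset.sum_filter]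
  refine Finset.sum_congr rfl fun U _ => ?_
  by_cases h : (∃ k ∈ U, k.val < N) ∧ e₀ ∉ U
  · have hne : U.Nonempty := h.1.imp fun k hk => hk.1
    by_cases hT : T U <;> simp [h, hT, hne]
  · simp [h]

lemma card_signalIndex (e₀ : Fin K) :
    Fintype.card (SignalIndex ℓ N e₀) =
      keyCount ℓ (fun U => (∃ k ∈ U, k.val < N) ∧ e₀ ∉ U) := by
  have := card_filter_signalIndex (ℓ := ℓ) (N := N) e₀ fun _ => True
  simpa using this

lemma keyCount_congr {S T : Finset (Fin K) → Prop} (h : ∀ U, S U ↔ T U) :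
    keyCount ℓ S = keyCount ℓ T := by
  rw [funext fun U => propext (h U)]

/-- The number of key symbols known only to receivers in a given set. -/
lemma keyCount_subset (Lsym : ℕ → ℕ)
    (hsym : ∀ U : Finset (Fin K), U.Nonempty → ℓ U = Lsym U.card) (S : Finset (Fin K)) :
    keyCount ℓ (fun U => U ⊆ S) = ∑ u ∈ Finset.Icc 1 K, S.card.choose u * Lsym u := by
  classical
  -- The empty set carries no key, whatever `Lsym 0` is.
  set f : ℕ → ℕ := fun u => if u = 0 then 0 else Lsym u with hf
  have h1 : keyCount ℓ (fun U => U ⊆ S) = ∑ U ∈ S.powerset, f U.card := by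
    rw [keyCount, Finset.sum_filter, ← Finset.filter_subset_univ, Finset.sum_filter]
    refine Finset.sum_congr rfl fun U _ => ?_
    rcases U.eq_empty_or_nonempty with rfl | hU
    · simp [hf]
    · simp [hf, hU, hsym U hU, hU.ne_empty]
  have hS : S.card ≤ K := by simpa using Finset.card_le_univ S
  rw [h1, Finset.sum_powerset_apply_card,
    Finset.sum_subset (Finset.range_subset_range.2 (Nat.succ_le_succ hS))]
  · symm
    refine (Finset.sum_congr rfl fun u hu => ?_).trans
      (Finset.sum_subset (s₁ := Finset.Icc 1 K) ?_ ?_)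
    · have : u ≠ 0 := by
        have := (Finset.mem_Icc.1 hu).1
        omega
      simp [hf, this]
    · intro u hu
      simp only [Finset.mem_Icc, Finset.mem_range] at hu ⊢
      omega
    · intro u hu hu'
      have : u = 0 := by
        simp only [Finset.mem_Icc, Finset.mem_range] at hu hu'
        omega
      simp [hf, this]
  · intro u _ hu
    rw [Nat.choose_eq_zero_of_lt, zero_smul]
    simp only [Finset.mem_range] at hu
    omega

lemma keyCount_subset_and_not {S S' : Finset (Fin K)} (h : S' ⊆ S) :
    keyCount ℓ (fun U => U ⊆ S) =
      keyCount ℓ (fun U => U ⊆ S') + keyCount ℓ (fun U => U ⊆ S ∧ ¬ U ⊆ S') := by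
  rw [← keyCount_or]
  exact keyCount_congr fun U => ⟨.inl, fun hU => hU.elim id fun h' => h'.trans h⟩

/-- The number of key symbols known to one receiver and not to another one. -/
lemma keyCount_mem_notMem (Lsym : ℕ → ℕ)
    (hsym : ∀ U : Finset (Fin K), U.Nonempty → ℓ U = Lsym U.card) {k e : Fin K} (hke : k ≠ e) :
    keyCount ℓ (fun U => k ∈ U ∧ e ∉ U) =
      ∑ u ∈ Finset.Icc 1 K, (K - 2).choose (u - 1) * Lsym u := by
  classical
  have h := keyCount_subset_and_not (ℓ := ℓ)
    (Finset.erase_subset k (Finset.univ.erase e))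
  have hk : k ∈ Finset.univ.erase e := by simp [hke]
  have hK : 2 ≤ K := by
    have h1 := k.2
    have h2 := e.2
    have h3 : k.val ≠ e.val := fun h => hke (Fin.ext h)
    omega
  rw [keyCount_subset Lsym hsym, keyCount_subset Lsym hsym, Finset.card_erase_of_mem hk,
    Finset.card_erase_of_mem (Finset.mem_univ e), Finset.card_univ, Fintype.card_fin,
    keyCount_congr (T := fun U => k ∈ U ∧ e ∉ U)] at h
  · have h2 : ∑ u ∈ Finset.Icc 1 K, (K - 1).choose u * Lsym u =
        ∑ u ∈ Finset.Icc 1 K, (K - 1 - 1).choose u * Lsym u +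
          ∑ u ∈ Finset.Icc 1 K, (K - 2).choose (u - 1) * Lsym u := by
      rw [← Finset.sum_add_distrib]
      refine Finset.sum_congr rfl fun u hu => ?_
      obtain ⟨v, rfl⟩ := Nat.exists_eq_add_of_le' (Finset.mem_Icc.1 hu).1
      obtain ⟨M, rfl⟩ := Nat.exists_eq_add_of_le' hK
      have h3 : M + 2 - 1 = M + 1 := rfl
      simp only [h3, Nat.add_sub_cancel, Nat.choose_succ_succ']
      ring
    omega
  · intro U
    have h1 : U ⊆ Finset.univ.erase e ↔ e ∉ U := by simp [Finset.subset_erase]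
    have h2 : U ⊆ (Finset.univ.erase e).erase k ↔ U ⊆ Finset.univ.erase e ∧ k ∉ U :=
      Finset.subset_erase
    rw [h2, h1]
    tauto

/-- The number of key symbols known to a legitimate receiver and not to the last receiver. -/
lemma keyCount_legitimate_notMem (Lsym : ℕ → ℕ)
    (hsym : ∀ U : Finset (Fin K), U.Nonempty → ℓ U = Lsym U.card) (e : Fin K)
    (he : e.val + 1 = K) (hN : N ≤ e.val) :
    keyCount ℓ (fun U => (∃ k ∈ U, k.val < N) ∧ e ∉ U) +
        ∑ u ∈ Finset.Icc 1 K, (K - N - 1).choose u * Lsym u =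
      ∑ u ∈ Finset.Icc 1 K, (K - 1).choose u * Lsym u := by
  classical
  -- The eavesdroppers other than `e`; they form an interval because `e` is the last receiver.
  set S' : Finset (Fin K) := Finset.Ico ⟨N, hN.trans_lt e.2⟩ e with hS'
  have hmem : ∀ k, k ∈ S' ↔ N ≤ k.val ∧ k ≠ e := by
    intro k
    have := k.2
    rw [hS', Finset.mem_Ico, Fin.le_def, Fin.lt_def, Ne, Fin.ext_iff]
    simp only
    omega
  have h := keyCount_subset_and_not (ℓ := ℓ) (S := Finset.univ.erase e) (S' := S')
    (fun k hk => by simpa using ((hmem k).1 hk).2)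
  have hcard : S'.card = K - N - 1 := by
    rw [hS', Fin.card_Ico]
    simp only
    omega
  rw [keyCount_subset Lsym hsym, keyCount_subset Lsym hsym, hcard,
    Finset.card_erase_of_mem (Finset.mem_univ e), Finset.card_univ, Fintype.card_fin,
    keyCount_congr (T := fun U => (∃ k ∈ U, k.val < N) ∧ e ∉ U)] at h
  · omega
  · intro U
    have h1 : U ⊆ Finset.univ.erase e ↔ e ∉ U := by simp [Finset.subset_erase]
    rw [h1, and_comm]
    refine and_congr_left fun heU => ?_
    rw [Finset.not_subset]
    refine exists_congr fun k => and_congr_right fun hk => ?_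
    have : k ≠ e := fun h => heU (h ▸ hk)
    rw [hmem]
    simp [this]

end Counting


variable {F : Type*} [Fintype F] {K : ℕ} {ℓ : Finset (Fin K) → ℕ} {N : ℕ}

lemma rate_eq {L R : ℕ} (c : Scheme F ℓ N L) (hc : c.LW = R * L) (hL : 0 < L) :
    c.rate = R * Real.logb 2 (Fintype.card F) := by
  have : (L : ℝ) ≠ 0 := by exact_mod_cast hL.ne'
  rw [Scheme.rate, hc]
  push_cast
  field_simp

lemma bandwidth_eq {L B : ℕ} (c : Scheme F ℓ N L) (hc : c.LX = B * L) (hL : 0 < L) :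
    c.bandwidth = B * Real.logb 2 (Fintype.card F) := by
  have : (L : ℝ) ≠ 0 := by exact_mod_cast hL.ne'
  rw [Scheme.bandwidth, hc]
  push_cast
  field_simp

variable [Field F]

/-! ### Capacity-achieving sequences. -/

section Achievability

/-- The schemes that attain capacity with minimum bandwidth; they are perfect as soon as the code
alphabet is large enough. -/
lemma exists_scheme
    (hsym : ∀ U V : Finset (Fin K), U.Nonempty → V.Nonempty → U.card = V.card → ℓ U = ℓ V)
    (e₀ : Fin K) (R B : ℕ)
    (hR : ∀ k : Fin K, k.val < N → keyCount ℓ (fun U => k ∈ U ∧ e₀ ∉ U) = R)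
    (hB : keyCount ℓ (fun U => (∃ k ∈ U, k.val < N) ∧ e₀ ∉ U) = B) (L : ℕ) :
    ∃ c : Scheme F ℓ N L, c.LW = R * L ∧ c.LX = B * L ∧
      (L ≠ 0 → B ≤ Fintype.card F ^ L →
        (∀ k, c.errorProb k = 0) ∧ (∀ k : Fin K, k.val < N → c.equivocation k = 0) ∧
          ∀ e : Fin K, N ≤ e.val → c.leakage e = 0) := by
  classical
  by_cases hL : L ≠ 0 ∧ B ≤ Fintype.card F ^ L
  · obtain ⟨D, hD⟩ := exists_mds_code (F := F) (J := SignalIndex ℓ N e₀) hL.1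
      (by rw [card_signalIndex, hB]; exact hL.2) R
    have hcard : Fintype.card (SignalIndex ℓ N e₀ × Fin L) = Fintype.card (Fin (B * L)) := by
      rw [Fintype.card_prod, card_signalIndex, hB, Fintype.card_fin, Fintype.card_fin]
    let φ : (SignalIndex ℓ N e₀ → Fin L → F) ≃ (Fin (B * L) → F) :=
      (Equiv.curry _ _ _).symm.trans (Equiv.arrowCongr (Fintype.equivOfCardEq hcard) (Equiv.refl F))
    let f : (Fin (R * L) → F) → Keys F ℓ L → (Fin (B * L) → F) :=
      fun w s => φ (D w + keyCombination N e₀ s)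
    have hdec := fun k : {k : Fin K // k.val < N} => Scheme.ofEncoder_dec f k
      fun w w' s s' hx hs => by
        have hx' := φ.injective hx
        refine hD (Finset.univ.filter fun j : SignalIndex ℓ N e₀ => k.1 ∈ j.1.1) ?_ w w' ?_
        · rw [card_filter_signalIndex e₀ (fun U => k.1 ∈ U), ← hR k.1 k.2]
          refine le_of_eq (keyCount_congr fun U => ?_)
          exact ⟨fun h => ⟨h.1, ⟨k.1, h.1, k.2⟩, h.2⟩, fun h => ⟨h.1, h.2.2⟩⟩
        · intro j hj
          funext l
          have h1 := congrFun (congrFun hx' j) l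
          simp only [Pi.add_apply] at h1
          rw [keyCombination_congr k.2 hs (Finset.mem_filter.1 hj).2] at h1
          exact add_right_cancel h1
    refine ⟨Scheme.ofEncoder N f, rfl, rfl, fun _ _ => ⟨fun k => ?_, fun k hk => ?_, fun e he => ?_⟩⟩
    · exact Scheme.errorProb_eq_zero _ f (fun _ _ => rfl) k (hdec k)
    · exact Scheme.equivocation_eq_zero _ f (fun _ _ => rfl) ⟨k, hk⟩ (hdec ⟨k, hk⟩)
    · refine Scheme.leakage_eq_zero _ f (fun _ _ => rfl) e fun w w' => ?_
      -- The shift turns the masked codeword of `w` into that of `w'`.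
      refine ⟨keyShift (D w' - D w) e, fun s => ⟨?_, receiverKey_add_keyShift _ e s⟩⟩
      refine congrArg φ ?_
      rw [keyCombination_add, keyCombination_keyShift hsym _ he]
      abel
  -- For the finitely many short block lengths any scheme with the right dimensions will do, as
  -- correctness and security are asymptotic.
  · refine ⟨Scheme.ofEncoder (LW := R * L) (LX := B * L) N fun _ _ => 0, rfl, rfl, fun h1 h2 => ?_⟩
    exact absurd ⟨h1, h2⟩ hL

lemma achievableBandwidth
    (hsym : ∀ U V : Finset (Fin K), U.Nonempty → V.Nonempty → U.card = V.card → ℓ U = ℓ V)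
    (e₀ : Fin K) (R B : ℕ)
    (hR : ∀ k : Fin K, k.val < N → keyCount ℓ (fun U => k ∈ U ∧ e₀ ∉ U) = R)
    (hB : keyCount ℓ (fun U => (∃ k ∈ U, k.val < N) ∧ e₀ ∉ U) = B) (r : Reliability) :
    AchievableBandwidth F ℓ N r (R * Real.logb 2 (Fintype.card F))
      (B * Real.logb 2 (Fintype.card F)) := by
  choose c hW hX hc using exists_scheme (F := F) hsym e₀ R B hR hB
  have hlarge : ∀ᶠ L : ℕ in atTop, L ≠ 0 ∧ B ≤ Fintype.card F ^ L := by
    filter_upwards [eventually_ge_atTop (B + 1)] with L hL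
    refine ⟨by omega, ?_⟩
    have := Nat.lt_pow_self (n := L) (Fintype.one_lt_card (α := F))
    omega
  refine ⟨c, ?_, fun k hk => ?_, fun L hL =>
    ⟨(rate_eq _ (hW L) hL).ge, (bandwidth_eq _ (hX L) hL).le⟩⟩
  · cases r with
    | vanishingError =>
      intro k
      refine tendsto_const_nhds.congr' ?_
      filter_upwards [hlarge] with L hL
      exact ((hc L hL.1 hL.2).1 k).symm
    | vanishingEquivocation =>
      intro k hk
      refine (isLittleO_zero _ _).congr' ?_ EventuallyEq.rfl
      filter_upwards [hlarge] with L hL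
      exact ((hc L hL.1 hL.2).2.1 k hk).symm
  · refine (isLittleO_zero _ _).congr' ?_ EventuallyEq.rfl
    filter_upwards [hlarge] with L hL
    exact ((hc L hL.1 hL.2).2.2 k hk).symm

end Achievability

/-! ### Asymptotic converse bounds. -/

section Converse

/-- Fano's bound is o(L) only if the message length is O(L), which is not assumed. Security against
`e` supplies this through `msg_length_le`. -/
lemma isCorrect_vanishingEquivocation {r : Reliability} {c : (L : ℕ) → Scheme F ℓ N L}
    (hc : IsCorrect r c) (hs : IsSecure c) (e : Fin K) (he : N ≤ e.val) :
    IsCorrect .vanishingEquivocation c := by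
  cases r with
  | vanishingEquivocation => exact hc
  | vanishingError =>
    intro k hk
    have herr : Tendsto (fun L => (c L).errorProb ⟨k, hk⟩) atTop (nhds 0) := hc ⟨k, hk⟩
    set A : ℝ := keyCount ℓ (fun U => k ∈ U ∧ e ∉ U) * Real.logb 2 (Fintype.card F) with hA
    have hone : (fun _ : ℕ => (1 : ℝ)) =o[atTop] fun L : ℕ => (L : ℝ) :=
      isLittleO_const_left.2 (.inr (tendsto_norm_atTop_atTop.comp tendsto_natCast_atTop_atTop))
    have hlen : (fun L : ℕ => 2 * (A * L + 1 + |(c L).leakage e|)) =O[atTop]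
        fun L : ℕ => (L : ℝ) :=
      ((((isBigO_refl _ _).const_mul_left A).add hone.isBigO).add
        (hs e he).isBigO.norm_left).const_mul_left 2
    have hprod : (fun L : ℕ => (c L).errorProb ⟨k, hk⟩ *
        (2 * (A * L + 1 + |(c L).leakage e|))) =o[atTop] fun L : ℕ => (L : ℝ) := by
      have := ((isLittleO_one_iff ℝ).2 herr).mul_isBigO hlen
      simpa using this
    refine (IsBigO.of_bound 1 ?_).trans_isLittleO (hone.add hprod)
    filter_upwards [herr.eventually (gt_mem_nhds (show (0 : ℝ) < 1 / 2 by norm_num))] with L hL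
    have hp : 0 ≤ (c L).errorProb ⟨k, hk⟩ := prob_nonneg _ _ _
    have h1 := (c L).equivocation_le_fano ⟨k, hk⟩
    have h2 := (c L).msg_length_le k e
    have h3 := (c L).equivocation_nonneg k
    have h4 := le_abs_self ((c L).leakage e)
    set M := ((c L).LW : ℝ) * Real.logb 2 (Fintype.card F)
    have hM0 : 0 ≤ M := mul_nonneg (Nat.cast_nonneg _)
      (Real.logb_nonneg (by norm_num) (by exact_mod_cast Fintype.card_pos))
    -- Fano inside `msg_length_le` gives M ≤ A L + 1 + p M + leakage; the term p M is absorbed since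
    -- p < 1/2.
    have hM : M ≤ 2 * (A * L + 1 + |(c L).leakage e|) := by
      rw [hA]
      simp only at h1
      nlinarith
    have h5 := mul_le_mul_of_nonneg_left hM hp
    simp only at h1
    rw [one_mul, Real.norm_of_nonneg h3, Real.norm_of_nonneg]
    · linarith
    · linarith [mul_nonneg hp hM0]

lemma rate_le {r : Reliability} {R : ℝ} (h : AchievableRate F ℓ N r R) (k e : Fin K)
    (hk : k.val < N) (he : N ≤ e.val) :
    R ≤ keyCount ℓ (fun U => k ∈ U ∧ e ∉ U) * Real.logb 2 (Fintype.card F) := by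
  obtain ⟨c, hc, hs, hrate⟩ := h
  have hq := isCorrect_vanishingEquivocation hc hs e he k hk
  have hlim := ((hq.add (hs e he)).tendsto_div_nhds_zero).const_add
    (keyCount ℓ (fun U => k ∈ U ∧ e ∉ U) * Real.logb 2 (Fintype.card F))
  rw [add_zero] at hlim
  refine ge_of_tendsto hlim ?_
  filter_upwards [eventually_gt_atTop 0] with L hL
  have hL' : (0 : ℝ) < L := by exact_mod_cast hL
  refine (hrate L hL).trans ?_
  have := (c L).msg_length_le k e
  rw [Scheme.rate, div_le_iff₀ hL', add_mul, div_mul_cancel₀ _ hL'.ne']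
  linarith

/-- With rate at least `A`, the linear terms in the sum of `key_length_le` are nonpositive, and only
o(L) remains. -/
lemma le_bandwidth {r : Reliability} {A b : ℝ} (e : Fin K) (he : N ≤ e.val)
    (hA : ∀ k : Fin K, k.val < N →
      keyCount ℓ (fun U => k ∈ U ∧ e ∉ U) * Real.logb 2 (Fintype.card F) = A)
    (h : AchievableBandwidth F ℓ N r A b) :
    keyCount ℓ (fun U => (∃ k ∈ U, k.val < N) ∧ e ∉ U) * Real.logb 2 (Fintype.card F) ≤ b := by
  obtain ⟨c, hc, hs, hrate⟩ := h
  have hq := isCorrect_vanishingEquivocation hc hs e he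
  have hsum : (fun L : ℕ => ∑ k : Fin K with k.val < N,
      ((c L).equivocation k + (c L).leakage e)) =o[atTop] fun L : ℕ => (L : ℝ) :=
    IsLittleO.fun_sum fun k hk => (hq k (Finset.mem_filter.1 hk).2).add (hs e he)
  have hlim := hsum.tendsto_div_nhds_zero.const_add b
  rw [add_zero] at hlim
  refine ge_of_tendsto hlim ?_
  filter_upwards [eventually_gt_atTop 0] with L hL
  have hL' : (0 : ℝ) < L := by exact_mod_cast hL
  obtain ⟨h1, h2⟩ := hrate L hL
  rw [Scheme.rate, le_div_iff₀ hL'] at h1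
  rw [Scheme.bandwidth, div_le_iff₀ hL'] at h2
  have h3 := (c L).key_length_le e
  have h4 : ∑ k : Fin K with k.val < N, ((c L).equivocation k + (c L).leakage e -
      (c L).LW * Real.logb 2 (Fintype.card F) +
        L * keyCount ℓ (fun U => k ∈ U ∧ e ∉ U) * Real.logb 2 (Fintype.card F)) ≤
      ∑ k : Fin K with k.val < N, ((c L).equivocation k + (c L).leakage e) := by
    refine Finset.sum_le_sum fun k hk => ?_
    have := hA k (Finset.mem_filter.1 hk).2
    rw [mul_assoc, this]
    linarith
  rw [← sub_le_iff_le_add', le_div_iff₀ hL']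
  linarith

end Converse

end SecureGroupcast

theorem theorem6 {F : Type*} [Field F] [Fintype F] (K N : ℕ) (hN : 1 ≤ N) (hNK : N + 1 ≤ K)
    (ℓ : Finset (Fin K) → ℕ) (Lsym : ℕ → ℕ)
    (hsym : ∀ U : Finset (Fin K), U.Nonempty → ℓ U = Lsym U.card)
    (r : SecureGroupcast.Reliability) (C B : ℝ)
    (hC : C = ∑ u ∈ Finset.Icc 1 K,
      ((K - 2).choose (u - 1) : ℝ) * (Lsym u : ℝ) * Real.logb 2 (Fintype.card F))
    (hB : B = ∑ u ∈ Finset.Icc 1 K,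
      (((K - 1).choose u : ℝ) - ((K - N - 1).choose u : ℝ)) * (Lsym u : ℝ) *
        Real.logb 2 (Fintype.card F)) :
    SecureGroupcast.IsCapacity F ℓ N r C ∧ SecureGroupcast.IsMinBandwidth F ℓ N r C B := by
  -- The last receiver serves both as the e₀ of the scheme and as the eavesdropper in the converse.
  open SecureGroupcast in
  let e : Fin K := ⟨K - 1, by omega⟩
  have he : N ≤ e.val := by
    change N ≤ K - 1
    omega
  let k₀ : Fin K := ⟨0, by omega⟩
  have hRk : ∀ k : Fin K, k.val < N → keyCount ℓ (fun U => k ∈ U ∧ e ∉ U) =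
      ∑ u ∈ Finset.Icc 1 K, (K - 2).choose (u - 1) * Lsym u := fun k hk =>
    keyCount_mem_notMem Lsym hsym fun h => absurd he (not_le.2 (h ▸ hk))
  have hC' : ∀ k : Fin K, k.val < N →
      keyCount ℓ (fun U => k ∈ U ∧ e ∉ U) * Real.logb 2 (Fintype.card F) = C := by
    intro k hk
    rw [hRk k hk, hC, ← Finset.sum_mul]
    push_cast
    rfl
  have hB' : keyCount ℓ (fun U => (∃ k ∈ U, k.val < N) ∧ e ∉ U) *
      Real.logb 2 (Fintype.card F) = B := by
    have h := keyCount_legitimate_notMem Lsym hsym e (Nat.sub_add_cancel (by omega)) he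
    rw [hB, ← Finset.sum_mul]
    congr 1
    have h' := congrArg (Nat.cast : ℕ → ℝ) h
    push_cast at h'
    simp only [sub_mul, Finset.sum_sub_distrib]
    linarith
  have hach : AchievableBandwidth F ℓ N r C B := by
    rw [← hB', ← hC' k₀ hN, hRk k₀ hN]
    refine achievableBandwidth (fun U V hU hV h => ?_) e _ _ hRk rfl r
    rw [hsym U hU, hsym V hV, h]
  constructor
  · refine IsGreatest.isLUB ⟨?_, fun R hR => ?_⟩
    · obtain ⟨c, h1, h2, h3⟩ := hach
      exact ⟨c, h1, h2, fun L hL => (h3 L hL).1⟩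
    · exact (rate_le hR k₀ e hN he).trans_eq (hC' k₀ hN)
  · refine IsLeast.isGLB ⟨hach, fun b hb => ?_⟩
    exact hB'.symm.trans_le (le_bandwidth e he hC' hb)
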